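/- Let $\mathcal L$ be an algebraic language (operation symbols only; algebras are non-empty). For a class $K$ of $\mathcal L$-algebras, $\mathrm{ISP}(K)$ is the class of isomorphic copies of subalgebras of (possibly empty) products of members of $K$. A quasi-identity $\Sigma\Rightarrow\varphi\approx\psi$ ($\Sigma$ a finite set of identities between terms in countably many variables) is *valid* in $K$ if every assignment into a member of $K$ that satisfies all identities of $\Sigma$ satisfies $\varphi\approx\psi$; it is *admissible* in $K$ if every substitution $\sigma$ for which $\sigma(\varphi')\approx\sigma(\psi')$ is valid in $K$ for all $\varphi'\approx\psi'$ in $\Sigma$ also makes $\sigma(\varphi)\approx\sigma(\psi)$ valid in $K$. Let $M$ be a finite $\mathcal L$-algebra generated by $s$ elements ($s\in\mathbb N$), and let $F_M(s)\in \mathrm{ISP}(M)$ be the free $s$-generated algebra for $M$: it is generated by a family $g_1,\dots,g_s$ such that every map $g_i\mapsto m_i\in M$ extends to a homomorphism $F_M(s)\to M$. Let $\widetilde M=(M;G,H,R,\mathcal T)$ be an *alter ego* of $M$: $\mathcal T$ is the discrete topology, each $g\in G$ is a homomorphism $M^n\to M$ ($n\ge 0$), each $h\in H$ is a homomorphism from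 a subalgebra of $M^n$ to $M$ ($n\ge1$), and each $r\in R$ is a subalgebra of $M^n$ ($n\ge1$); in the last two cases the subalgebra may be empty, or all of $M^n$. Powers of $\widetilde M$ carry the product topology and the pointwise structure; a substructure is a subset closed under $G$ and, where defined, under $H$, with the inherited structure; morphisms are continuous maps preserving the operations, the partial operations (with their domains) and the relations; an embedding is a morphism that is an isomorphism onto a substructure of its codomain. Let $\mathcal X=\mathrm{IS_cP^+}(\widetilde M)$ be the category of isomorphic copies of closed substructures of non-empty powers of $\widetilde M$, together with the empty structure. For $A\in\mathrm{ISP}(M)$ let $D(A)$ be the set of homomorphisms $A\to M$, as a substructure of $\widetilde M^A$; for a structure $X$ of the type of $\widetilde M$ let $E(X)$ be the set of morphisms $X\to\widetilde M$, as a subalgebra of $M^X$. Assume that $\widetilde M$ yields a *strong duality* on $\mathrm{ISP}(M)$: for every $A\in\mathrm{ISP}(M)$ the evaluation map $A\to E(D(A))$, $a\mapsto(x\mapsto x(a))$, is surjective, and $\widetilde M$ is injective in $\mathcal X$ with respect to embeddings. Let $(X,\gamma,\eta)$ be a *Test Space configuration*: $X$ is a substructure of $\widetilde M^s$, $\gamma:\widetilde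 M^s\to X$ is a surjective morphism and $\eta:D(M)\to X$ is an embedding. Then $\mathrm{ISP}(F_M(s))=\mathrm{ISP}(E(X))$, and for every quasi-identity $\Sigma\Rightarrow\varphi\approx\psi$ the following are equivalent: (1) $\Sigma\Rightarrow\varphi\approx\psi$ is admissible in $\mathrm{ISP}(M)$; (2) $\Sigma\Rightarrow\varphi\approx\psi$ is valid in $E(X)$. -/

import Mathlib

open scoped FirstOrder

universe ul vl u v w

namespace NaturalDuality

/-! ## Algebras, class operators, free algebras, quasi-identities -/

section Algebra

variable (L : FirstOrder.Language.{ul, vl})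

/-- `L`-algebras with universe in `Type u` (used only for languages `L` without relation
symbols). Where the mathematics wants non-empty algebras this is said explicitly. -/
abbrev Alg := CategoryTheory.Bundled.{u} (fun A : Type u => L.Structure A)

variable {L}

/-- A type with a given `L`-algebra structure, as a member of `Alg L`. -/
abbrev Alg.of (A : Type u) [s : L.Structure A] : Alg.{ul, vl, u} L := ⟨A, s⟩

/-- The direct product of a family of algebras: all operations are pointwise. -/
instance piStructure {I : Type w} (B : I → Type u) [∀ i, L.Structure (B i)] :
    L.Structure (∀ i, B i) where
  funMap f x := fun i => FirstOrder.Language.Structure.funMap f (fun k => x k i)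
  RelMap r x := ∀ i, FirstOrder.Language.Structure.RelMap r (fun k => x k i)

/-- Isomorphic copies of members of `K`. -/
def classI (K : Set (Alg.{ul, vl, u} L)) : Set (Alg.{ul, vl, u} L) :=
  {A | ∃ B ∈ K, Nonempty (A ≃[L] B)}

/-- (Non-empty) subalgebras of members of `K`. -/
def classS (K : Set (Alg.{ul, vl, u} L)) : Set (Alg.{ul, vl, u} L) :=
  {A | ∃ B ∈ K, ∃ T : L.Substructure B, (T : Set B).Nonempty ∧ A = Alg.of T}

/-- Direct products of (possibly empty) families of members of `K`. -/
def classP (K : Set (Alg.{ul, vl, u} L)) : Set (Alg.{ul, vl, u} L) :=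
  {A | ∃ (I : Type u) (B : I → Alg.{ul, vl, u} L), (∀ i, B i ∈ K) ∧ A = Alg.of (∀ i, B i)}

/-- The class `ISP(K)`. -/
def ISP (K : Set (Alg.{ul, vl, u} L)) : Set (Alg.{ul, vl, u} L) :=
  classI (classS (classP K))

/-- `F` is a free `s`-generated algebra for the class `K`: it lies in `ISP(K)`, and it is generated
by a family `g` of `s` elements such that every map from these generators to a member of `K`
extends to a homomorphism. (The extension is unique, because the `g i` generate `F`.) -/
def IsFreeAlg (K : Set (Alg.{ul, vl, u} L)) (s : ℕ) (F : Alg.{ul, vl, u} L) : Prop :=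
  F ∈ ISP K ∧ ∃ g : Fin s → F, FirstOrder.Language.Substructure.closure L (Set.range g) = ⊤ ∧
    ∀ A ∈ K, ∀ f : Fin s → A, ∃ h : F →[L] A, ∀ i, h (g i) = f i

/-- The free `s`-generated algebra for `M` exists, when `M` is generated by `s` elements: it is the
subalgebra of `M ^ (M ^ s)` generated by the coordinate projections. -/
theorem exists_isFreeAlg [L.IsAlgebraic] (M : Type u) [L.Structure M] [Nonempty M] (s : ℕ)
    (hs : ∃ m : Fin s → M, FirstOrder.Language.Substructure.closure L (Set.range m) = ⊤) :
    ∃ F : Alg.{ul, vl, u} L, IsFreeAlg {Alg.of (L := L) M} s F := by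
  let pr : Fin s → ((Fin s → M) → M) := fun i x => x i
  let T := FirstOrder.Language.Substructure.closure L (Set.range pr)
  let ev : (Fin s → M) → (((Fin s → M) → M) →[L] M) := fun f =>
    ⟨fun p => p f, fun _ _ => rfl, fun r _ => isEmptyElim r⟩
  have hT : (T : Set ((Fin s → M) → M)).Nonempty := by
    by_contra h
    obtain ⟨m, hm⟩ := hs
    obtain ⟨a⟩ := ‹Nonempty M›
    have key : FirstOrder.Language.Substructure.closure L (Set.range m) = T.map (ev m) := by
      rw [FirstOrder.Language.Substructure.map_closure]
      congr 1
      rw [← Set.range_comp]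
      rfl
    have : a ∈ T.map (ev m) := by
      rw [← key, hm]
      trivial
    obtain ⟨p, hp, -⟩ := this
    exact h ⟨p, hp⟩
  let g : Fin s → T := fun i => ⟨pr i, FirstOrder.Language.Substructure.subset_closure ⟨i, rfl⟩⟩
  refine ⟨Alg.of T, ⟨Alg.of T, ⟨Alg.of ((Fin s → M) → M),
    ⟨(Fin s → M), fun _ => Alg.of M, fun _ => rfl, rfl⟩, T, hT, rfl⟩,
    ⟨FirstOrder.Language.Equiv.refl L _⟩⟩, g, ?_, ?_⟩
  · rw [eq_top_iff]
    intro x _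
    have h : (FirstOrder.Language.Substructure.closure L (Set.range g)).map T.subtype.toHom
        = T := by
      rw [FirstOrder.Language.Substructure.map_closure]
      congr 1
      rw [← Set.range_comp]
      rfl
    have hx : x.1 ∈
        (FirstOrder.Language.Substructure.closure L (Set.range g)).map T.subtype.toHom := by
      rw [h]
      exact x.2
    obtain ⟨y, hy, e⟩ := hx
    have hyx : y = x := Subtype.ext e
    exact hyx ▸ hy
  · rintro A rfl f
    exact ⟨(ev f).comp T.subtype.toHom, fun i => rfl⟩

variable (L)

/-- An identity `φ ≈ ψ`: a pair of formulas, i.e. of terms in countably many variables. -/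
abbrev Identity := L.Term ℕ × L.Term ℕ

/-- A quasi-identity `Σ ⇒ φ ≈ ψ`. -/
structure QuasiIdentity where
  /-- the finite set `Σ` of premises -/
  premises : Finset (Identity L)
  /-- the conclusion `φ ≈ ψ` -/
  conclusion : Identity L

variable {L}

/-- The assignment `v` (equivalently, the homomorphism from the formula algebra to `A` that it
induces) satisfies the identity `e`. -/
def Identity.SatisfiedBy (e : Identity L) {A : Type u} [L.Structure A] (v : ℕ → A) : Prop :=
  e.1.realize v = e.2.realize v

/-- The quasi-identity `q` is valid in the class `K`. -/
def QuasiIdentity.ValidIn (q : QuasiIdentity L) (K : Set (Alg.{ul, vl, u} L)) : Prop :=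
  ∀ A ∈ K, ∀ v : ℕ → A, (∀ e ∈ q.premises, Identity.SatisfiedBy e v) →
    Identity.SatisfiedBy q.conclusion v

/-- The identity `e` is valid in the class `K`. -/
def Identity.ValidIn (e : Identity L) (K : Set (Alg.{ul, vl, u} L)) : Prop :=
  ∀ A ∈ K, ∀ v : ℕ → A, Identity.SatisfiedBy e v

/-- The image of an identity under a substitution `σ` (an endomorphism of the formula algebra,
given by its values on the variables). -/
def Identity.subst (e : Identity L) (σ : ℕ → L.Term ℕ) : Identity L :=
  (e.1.subst σ, e.2.subst σ)

/-- The quasi-identity `q` is admissible in the class `K`: every substitution that makes all the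
premises valid in `K` also makes the conclusion valid in `K`. -/
def QuasiIdentity.Admissible (q : QuasiIdentity L) (K : Set (Alg.{ul, vl, u} L)) : Prop :=
  ∀ σ : ℕ → L.Term ℕ, (∀ e ∈ q.premises, Identity.ValidIn (Identity.subst e σ) K) →
    Identity.ValidIn (Identity.subst q.conclusion σ) K

end Algebra

/-! ## Topological structures -/

/-- The type `(G, H, R)` of a topological structure: symbols for total operations, partial
operations and relations, with their arities. -/
structure DualType where
  /-- symbols for total operations -/
  G : Type w
  /-- symbols for partial operations -/
  H : Type w
  /-- symbols for relations -/
  R : Type w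
  /-- arities of total operations -/
  arG : G → ℕ
  /-- arities of partial operations -/
  arH : H → ℕ
  /-- arities of relations -/
  arR : R → ℕ
  arH_pos : ∀ h, 1 ≤ arH h
  arR_pos : ∀ r, 1 ≤ arR r

/-- A topological structure of type `τ`. -/
structure TopStr (τ : DualType.{w}) where
  /-- the universe -/
  carrier : Type u
  /-- the topology -/
  top : TopologicalSpace carrier
  /-- the total operations -/
  gOp : ∀ g : τ.G, (Fin (τ.arG g) → carrier) → carrier
  /-- the domains of the partial operations -/
  hDom : ∀ h : τ.H, Set (Fin (τ.arH h) → carrier)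
  /-- the partial operations -/
  hOp : ∀ (h : τ.H) (x : Fin (τ.arH h) → carrier), x ∈ hDom h → carrier
  /-- the relations -/
  rel : ∀ r : τ.R, Set (Fin (τ.arR r) → carrier)

attribute [instance] TopStr.top

section TopStr

variable {τ : DualType.{w}}

/-- A morphism of topological structures: a continuous structure-preserving map. -/
structure Mor (X : TopStr.{u, w} τ) (Y : TopStr.{v, w} τ) where
  /-- the underlying map -/
  toFun : X.carrier → Y.carrier
  continuous_toFun : Continuous toFun
  map_gOp : ∀ (g : τ.G) (x : Fin (τ.arG g) → X.carrier),
    toFun (X.gOp g x) = Y.gOp g (fun i => toFun (x i))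
  map_hDom : ∀ (h : τ.H) (x : Fin (τ.arH h) → X.carrier), x ∈ X.hDom h →
    (fun i => toFun (x i)) ∈ Y.hDom h
  map_hOp : ∀ (h : τ.H) (x : Fin (τ.arH h) → X.carrier) (hx : x ∈ X.hDom h),
    toFun (X.hOp h x hx) = Y.hOp h (fun i => toFun (x i)) (map_hDom h x hx)
  map_rel : ∀ (r : τ.R) (x : Fin (τ.arR r) → X.carrier), x ∈ X.rel r →
    (fun i => toFun (x i)) ∈ Y.rel r

/-- An isomorphism: a morphism that has a two-sided inverse morphism. -/
def Mor.IsIso {X : TopStr.{u, w} τ} {Y : TopStr.{v, w} τ} (φ : Mor X Y) : Prop :=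
  ∃ ψ : Mor Y X, (∀ x, ψ.toFun (φ.toFun x) = x) ∧ ∀ y, φ.toFun (ψ.toFun y) = y

/-- The set `Z` is the universe of a substructure of `X`: it is closed under the total operations
and under the partial operations, where these are defined. -/
structure IsSubuniverse (X : TopStr.{u, w} τ) (Z : Set X.carrier) : Prop where
  gOp_mem : ∀ (g : τ.G) (x : Fin (τ.arG g) → X.carrier), (∀ i, x i ∈ Z) → X.gOp g x ∈ Z
  hOp_mem : ∀ (h : τ.H) (x : Fin (τ.arH h) → X.carrier) (hx : x ∈ X.hDom h), (∀ i, x i ∈ Z) →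
    X.hOp h x hx ∈ Z

/-- The substructure of `X` with universe `Z`. -/
def TopStr.sub (X : TopStr.{u, w} τ) (Z : Set X.carrier) (hZ : IsSubuniverse X Z) :
    TopStr.{u, w} τ where
  carrier := Z
  top := inferInstance
  gOp g x := ⟨X.gOp g (fun i => (x i : X.carrier)), hZ.gOp_mem g _ fun i => (x i).2⟩
  hDom h := {x | (fun i => (x i : X.carrier)) ∈ X.hDom h}
  hOp h x hx := ⟨X.hOp h (fun i => (x i : X.carrier)) hx, hZ.hOp_mem h _ hx fun i => (x i).2⟩
  rel r := {x | (fun i => (x i : X.carrier)) ∈ X.rel r}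

/-- The power `X ^ S`, with the product topology and the pointwise liftings of the operations,
partial operations and relations. -/
def TopStr.pow (X : TopStr.{u, w} τ) (S : Type v) : TopStr.{max v u, w} τ where
  carrier := S → X.carrier
  top := inferInstance
  gOp g x := fun s => X.gOp g (fun i => x i s)
  hDom h := {x | ∀ s, (fun i => x i s) ∈ X.hDom h}
  hOp h x hx := fun s => X.hOp h (fun i => x i s) (hx s)
  rel r := {x | ∀ s, (fun i => x i s) ∈ X.rel r}

/-- An embedding: a morphism `φ : X → Y` such that `φ(X)` is a substructure of `Y` and
`φ : X → φ(X)` is an isomorphism. -/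
def Mor.IsEmbedding {X : TopStr.{u, w} τ} {Y : TopStr.{v, w} τ} (φ : Mor X Y) : Prop :=
  ∃ (hZ : IsSubuniverse Y (Set.range φ.toFun)) (e : Mor X (Y.sub (Set.range φ.toFun) hZ)),
    e.IsIso ∧ ∀ x, (e.toFun x).1 = φ.toFun x

/-- Membership in `IS_cP⁺(N)`: isomorphic copies of closed substructures of non-empty powers
of `N`, together with the empty structure. -/
def InIScP (N : TopStr.{u, w} τ) (X : TopStr.{u, w} τ) : Prop :=
  IsEmpty X.carrier ∨
    ∃ (S : Type u) (_ : Nonempty S) (Z : Set (N.pow S).carrier)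
      (hZ : IsSubuniverse (N.pow S) Z),
      IsClosed Z ∧ ∃ e : Mor X ((N.pow S).sub Z hZ), e.IsIso

/-- `N` is injective in the category `IS_cP⁺(N)`, with respect to embeddings. -/
def IsInjectiveInIScP (N : TopStr.{u, w} τ) : Prop :=
  ∀ X Y : TopStr.{u, w} τ, InIScP N X → InIScP N Y →
    ∀ φ : Mor X Y, φ.IsEmbedding → ∀ α : Mor X N,
      ∃ β : Mor Y N, ∀ x, β.toFun (φ.toFun x) = α.toFun x

end TopStr

/-! ## Alter egos, the dual functors, strong dualities -/

section AlterEgo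

variable {L : FirstOrder.Language.{ul, vl}}

/-- An alter ego of the algebra `M`: a type `τ` and an interpretation of it on `M` that is
compatible with `M`. Total operations are homomorphisms `M ^ n → M`, partial operations are
homomorphisms from subalgebras of `M ^ n` to `M`, and relations are subalgebras of `M ^ n`. -/
structure AlterEgo (L : FirstOrder.Language.{ul, vl}) (M : Type u) [L.Structure M] where
  /-- the type of the alter ego -/
  τ : DualType.{w}
  /-- the total operations -/
  gHom : ∀ g : τ.G, (Fin (τ.arG g) → M) →[L] M
  /-- the domains of the partial operations -/
  hSub : ∀ h : τ.H, L.Substructure (Fin (τ.arH h) → M)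
  /-- the partial operations -/
  hHom : ∀ h : τ.H, hSub h →[L] M
  /-- the relations -/
  rSub : ∀ r : τ.R, L.Substructure (Fin (τ.arR r) → M)

variable {M : Type u} [L.Structure M]

/-- The alter ego as a topological structure, with the discrete topology on `M`. -/
def AlterEgo.str (N : AlterEgo.{ul, vl, u, w} L M) : TopStr.{u, w} N.τ where
  carrier := M
  top := ⊥
  gOp g x := N.gHom g x
  hDom h := {x | x ∈ N.hSub h}
  hOp h x hx := N.hHom h ⟨x, hx⟩
  rel r := {x | x ∈ N.rSub r}

variable [L.IsAlgebraic] (N : AlterEgo.{ul, vl, u, w} L M)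

/-- The set of homomorphisms from `A` to `M` is a subuniverse of the `A`-th power of
the alter ego. -/
theorem AlterEgo.isSubuniverse_hom (A : Type u) [L.Structure A] :
    IsSubuniverse (N.str.pow A) {x : A → M | ∃ f : A →[L] M, ∀ a, f a = x a} where
  gOp_mem := by
    intro g x hx
    choose f hf using hx
    refine ⟨⟨fun a => N.gHom g (fun i => f i a), ?_, ?_⟩, ?_⟩
    · intro n F y
      have : (fun i => f i (FirstOrder.Language.Structure.funMap F y))
          = FirstOrder.Language.Structure.funMap F (fun k => fun i => f i (y k)) := by
        funext i
        exact (f i).map_fun F y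
      change N.gHom g (fun i => f i (FirstOrder.Language.Structure.funMap F y)) = _
      rw [this]
      exact (N.gHom g).map_fun F _
    · intro n r
      exact isEmptyElim r
    · intro a
      change N.gHom g (fun i => f i a) = N.gHom g (fun i => x i a)
      congr 1
      funext i
      exact hf i a
  hOp_mem := by
    intro h x hx hx'
    choose f hf using hx'
    have hxf : ∀ a, (fun i => f i a) ∈ N.hSub h := by
      intro a
      have : (fun i => f i a) = fun i => x i a := by
        funext i
        exact hf i a
      rw [this]
      exact hx a
    refine ⟨⟨fun a => N.hHom h ⟨fun i => f i a, hxf a⟩, ?_, ?_⟩, ?_⟩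
    · intro n F y
      have : (⟨fun i => f i (FirstOrder.Language.Structure.funMap F y), hxf _⟩ : N.hSub h)
          = FirstOrder.Language.Structure.funMap F (fun k => (⟨fun i => f i (y k), hxf _⟩ : N.hSub h)) := by
        apply Subtype.ext
        funext i
        exact (f i).map_fun F y
      change N.hHom h ⟨fun i => f i (FirstOrder.Language.Structure.funMap F y), hxf _⟩ = _
      rw [this]
      exact (N.hHom h).map_fun F _
    · intro n r
      exact isEmptyElim r
    · intro a
      change N.hHom h ⟨fun i => f i a, hxf a⟩ = N.hHom h ⟨fun i => x i a, hx a⟩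
      congr 1
      apply Subtype.ext
      funext i
      exact hf i a

/-- The natural dual space `D(A)`: the set of homomorphisms from `A` to `M`, as a substructure of
the `A`-th power of the alter ego. -/
def AlterEgo.D (A : Type u) [L.Structure A] : TopStr.{u, w} N.τ :=
  (N.str.pow A).sub {x : A → M | ∃ f : A →[L] M, ∀ a, f a = x a} (N.isSubuniverse_hom A)

/-- The algebra `E(X)`: the set of morphisms from `X` to the alter ego, as a subalgebra
of the power `M ^ X`. -/
def AlterEgo.E (X : TopStr.{u, w} N.τ) : L.Substructure (X.carrier → M) where
  carrier := {p | ∃ φ : Mor X N.str, ∀ x, φ.toFun x = p x}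
  fun_mem := by
    intro n F p hp
    choose φ hφ using hp
    have hp' : p = fun k x => (φ k).toFun x := by
      funext k x
      exact (hφ k x).symm
    subst hp'
    have hD : ∀ (h : N.τ.H) (x : Fin (N.τ.arH h) → X.carrier), x ∈ X.hDom h →
        ∀ k, (fun i => (φ k).toFun (x i)) ∈ N.hSub h := fun h x hx k => (φ k).map_hDom h x hx
    refine ⟨⟨fun x => FirstOrder.Language.Structure.funMap (M := M) F (fun k => (φ k).toFun x),
      ?_, ?_, ?_, ?_, ?_⟩, fun x => rfl⟩
    · let _ : TopologicalSpace M := ⊥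
      have : DiscreteTopology M := ⟨rfl⟩
      have h1 : Continuous (fun x => fun k => ((φ k).toFun x : M)) :=
        continuous_pi fun k => (φ k).continuous_toFun
      have h2 : Continuous (fun y : Fin n → M => FirstOrder.Language.Structure.funMap (M := M) F y) :=
        continuous_of_discreteTopology
      exact h2.comp h1
    · intro g x
      have : (fun k => (φ k).toFun (X.gOp g x))
          = fun k => N.gHom g (fun i => (φ k).toFun (x i)) := by
        funext k
        exact (φ k).map_gOp g x
      rw [this]
      exact ((N.gHom g).map_fun F (fun k i => (φ k).toFun (x i))).symm
    · intro h x hx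
      exact (N.hSub h).fun_mem F (fun k i => (φ k).toFun (x i)) (hD h x hx)
    · intro h x hx
      have : (fun k => (φ k).toFun (X.hOp h x hx))
          = fun k => N.hHom h ⟨fun i => (φ k).toFun (x i), hD h x hx k⟩ := by
        funext k
        exact (φ k).map_hOp h x hx
      rw [this]
      exact ((N.hHom h).map_fun F
        (fun k => (⟨fun i => (φ k).toFun (x i), hD h x hx k⟩ : N.hSub h))).symm
    · intro r x hx
      exact (N.rSub r).fun_mem F (fun k i => (φ k).toFun (x i))
        (fun k => (φ k).map_rel r x hx)

/-- The evaluation map `e_A : A → E(D(A))`, `e_A(a)(x) = x(a)`. -/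
def AlterEgo.eval (A : Type u) [L.Structure A] (a : A) : N.E (N.D A) :=
  ⟨fun x => x.1 a,
    ⟨fun x => x.1 a, (continuous_apply (A := fun _ : A => N.str.carrier) a).comp
        continuous_subtype_val,
      fun _ _ => rfl, fun _ _ hx => hx a, fun _ _ _ => rfl, fun _ _ hx => hx a⟩,
    fun _ => rfl⟩

/-- The alter ego yields a duality on `ISP(M)`: every evaluation map `e_A : A → E(D(A))` is
surjective. (These maps are always embeddings, for `A` in `ISP(M)`.) -/
def AlterEgo.YieldsDuality : Prop :=
  ∀ A ∈ ISP {Alg.of (L := L) M}, Function.Surjective (N.eval A)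

/-- The alter ego yields a strong duality on `ISP(M)`: it yields a duality, and it is injective in
its category `IS_cP⁺` of structured topological spaces. -/
def AlterEgo.YieldsStrongDuality : Prop :=
  N.YieldsDuality ∧ IsInjectiveInIScP N.str

/-- A Test Space configuration `(X, γ, η)`: a substructure `X` of the `s`-th power of the alter ego,
a surjective morphism `γ` from this power onto `X`, and an embedding `η` of `D(M)` into `X`. -/
structure TSConfig (s : ℕ) where
  /-- the universe of `X` -/
  univ : Set (N.str.pow (Fin s)).carrier
  isSubuniverse : IsSubuniverse (N.str.pow (Fin s)) univ
  /-- the surjective morphism -/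
  γ : Mor (N.str.pow (Fin s)) ((N.str.pow (Fin s)).sub univ isSubuniverse)
  γ_surjective : Function.Surjective γ.toFun
  /-- the embedding -/
  η : Mor (N.D M) ((N.str.pow (Fin s)).sub univ isSubuniverse)
  η_embedding : η.IsEmbedding

variable {N} in
/-- The structure `X` of a Test Space configuration. -/
def TSConfig.X {s : ℕ} (T : TSConfig N s) : TopStr.{u, w} N.τ :=
  (N.str.pow (Fin s)).sub T.univ T.isSubuniverse

end AlterEgo

end NaturalDuality

/-!
Membership of an algebra in `ISP K` means that it is non-empty and that its points are separated by
homomorphisms into members of `K` (`mem_ISP_iff`). So the equality of the two classes amounts to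
`E(X) ∈ ISP(F)` and `F ∈ ISP(E(X))`, and identities valid in `M` are valid in all of `ISP(M)`.

* The dual of the free algebra `F` is the power `N ^ s` of the alter ego `N`, so the duality gives
  `F ≅ E(N ^ s)` (`IsFreeOn.exists_equiv_E`). Precomposition with the surjection `γ : N ^ s → X`
  then embeds `E(X)` into `F` (`TSConfig.exists_injective_hom_free`).
* The identity map of `M` is a point of `D(M)`, and a morphism `D(M) → N` given by evaluation at
  `m : M` sends it to `m`. By injectivity such a morphism extends along `η` to `X`, so evaluation
  at the image of this point under `η` is a surjective homomorphism `E(X) → M`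
  (`TSConfig.exists_surjective_hom`).
* Since `E(X)` is a subalgebra of a power of `M`, any homomorphism `F → M` lifts through this
  surjection; as homomorphisms to `M` separate the points of `F`, homomorphisms to `E(X)` do too.

If a quasi-identity `q` is valid in `E(X)`, then assignments into `M` can be lifted to `E(X)`, where
the substituted premises hold automatically and `q` applies; so `q` is admissible. Conversely, an
assignment into `E(X)` satisfying the premises may be regarded as an assignment into `F`. Its values
are terms in the free generators, and these terms form a substitution to which admissibility
applies.

The injectivity hypothesis speaks of non-empty powers only, whereas `X` lives in `N ^ s` with `s`
possibly `0`. In that case `X` is a point, `η` is an isomorphism, and the extension along `η` is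
immediate.
-/

universe v'

namespace NaturalDuality

open FirstOrder Language

/-! ### Identities, homomorphisms and the class operator `ISP` -/

section Algebra

variable {L : FirstOrder.Language.{ul, vl}}

theorem Identity.SatisfiedBy.map {e : Identity L} {A : Type u} {B : Type v} [L.Structure A]
    [L.Structure B] (h : A →[L] B) {v : ℕ → A} (he : e.SatisfiedBy v) :
    e.SatisfiedBy (h ∘ v) := by
  unfold Identity.SatisfiedBy at *
  rw [HomClass.realize_term, HomClass.realize_term, he]

theorem Identity.SatisfiedBy.of_map {e : Identity L} {A : Type u} {B : Type v} [L.Structure A]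
    [L.Structure B] {h : A →[L] B} (hinj : Function.Injective h) {v : ℕ → A}
    (he : e.SatisfiedBy (h ∘ v)) : e.SatisfiedBy v := by
  unfold Identity.SatisfiedBy at *
  rw [HomClass.realize_term, HomClass.realize_term] at he
  exact hinj he

theorem Identity.satisfiedBy_subst {e : Identity L} {σ : ℕ → L.Term ℕ} {A : Type u}
    [L.Structure A] {v : ℕ → A} :
    (e.subst σ).SatisfiedBy v ↔ e.SatisfiedBy fun n => (σ n).realize v := by
  simp only [Identity.SatisfiedBy, Identity.subst, Term.realize_subst]

variable [L.IsAlgebraic]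

/-- The homomorphism into a product whose components are the given homomorphisms. -/
def homPi {A : Type v} [L.Structure A] {I : Type w} {B : I → Type u} [∀ i, L.Structure (B i)]
    (f : ∀ i, A →[L] B i) : A →[L] (∀ i, B i) where
  toFun a i := f i a
  map_fun' F x := funext fun i => (f i).map_fun F x
  map_rel' r := isEmptyElim r

/-- The projection of a product of algebras to one of its factors. -/
def homProj {I : Type w} {B : I → Type u} [∀ i, L.Structure (B i)] (i : I) :
    (∀ i, B i) →[L] B i where
  toFun p := p i
  map_fun' _ _ := rfl
  map_rel' r := isEmptyElim r

theorem mem_ISP_iff {K : Set (Alg.{ul, vl, u} L)} {A : Alg.{ul, vl, u} L} :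
    A ∈ ISP K ↔ Nonempty A ∧ ∀ a b : A, a ≠ b → ∃ B ∈ K, ∃ h : A →[L] B, h a ≠ h b := by
  constructor
  · rintro ⟨_, ⟨_, ⟨I, B, hB, rfl⟩, S, ⟨x, hx⟩, rfl⟩, ⟨e⟩⟩
    refine ⟨⟨e.symm ⟨x, hx⟩⟩, fun a b hab => ?_⟩
    have hne : (e a).1 ≠ (e b).1 := fun h => hab (e.injective (Subtype.ext h))
    obtain ⟨i, hi⟩ := Function.ne_iff.1 hne
    exact ⟨B i, hB i, (homProj (B := fun i => B i) i).comp (S.subtype.toHom.comp e.toHom), hi⟩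
  · rintro ⟨⟨a₀⟩, hsep⟩
    choose B hB h hh using fun p : {p : A × A // p.1 ≠ p.2} => hsep p.1.1 p.1.2 p.2
    let f : A →[L] (∀ p, B p) := homPi (B := fun p => B p) h
    have hf : Function.Injective f := by
      intro a b hab
      by_contra hne
      exact hh ⟨(a, b), hne⟩ (congrFun hab ⟨(a, b), hne⟩)
    let f' : A ↪[L] (∀ p, B p) := Embedding.ofInjective hf
    exact ⟨_, ⟨_, ⟨_, B, hB, rfl⟩, f'.toHom.range, ⟨f' a₀, a₀, rfl⟩, rfl⟩, ⟨f'.equivRange⟩⟩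

theorem ISP_subset_of_mem {F G : Alg.{ul, vl, u} L} (h : F ∈ ISP {G}) : ISP {F} ⊆ ISP {G} := by
  intro A hA
  rw [mem_ISP_iff] at hA h ⊢
  refine ⟨hA.1, fun a b hab => ?_⟩
  obtain ⟨_, rfl, f, hf⟩ := hA.2 a b hab
  obtain ⟨_, rfl, k, hk⟩ := h.2 _ _ hf
  exact ⟨_, rfl, k.comp f, hk⟩

theorem Identity.validIn_ISP {e : Identity L} {M : Type u} [L.Structure M]
    (he : ∀ v : ℕ → M, e.SatisfiedBy v) : e.ValidIn (ISP {Alg.of (L := L) M}) := by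
  intro A hA v
  by_contra hne
  obtain ⟨_, rfl, h, hh⟩ := (mem_ISP_iff.1 hA).2 _ _ hne
  apply hh
  have := he (h ∘ v)
  unfold Identity.SatisfiedBy at this
  rwa [HomClass.realize_term, HomClass.realize_term] at this

end Algebra

/-! ### Free algebras -/

section Free

variable {L : FirstOrder.Language.{ul, vl}}

/-- The family `g` generates `F`, and every map from it to `M` extends to a homomorphism. -/
structure IsFreeOn (L : FirstOrder.Language.{ul, vl}) (M : Type u) [L.Structure M] {s : ℕ}
    {F : Type v} [L.Structure F] (g : Fin s → F) : Prop where
  closure_eq_top : Substructure.closure L (Set.range g) = ⊤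
  exists_hom : ∀ m : Fin s → M, ∃ h : F →[L] M, ∀ i, h (g i) = m i

variable {M : Type u} [L.Structure M] {s : ℕ} {F : Type v} [L.Structure F] {g : Fin s → F}

theorem IsFreeOn.hom_ext (hg : IsFreeOn L M g) {B : Type w} [L.Structure B] {h k : F →[L] B}
    (hk : ∀ i, h (g i) = k (g i)) : h = k :=
  Hom.eq_of_eqOn_dense hg.closure_eq_top (by rintro _ ⟨i, rfl⟩; exact hk i)

theorem IsFreeOn.exists_term (hg : IsFreeOn L M g) (a : F) :
    ∃ t : L.Term (Fin s), t.realize g = a := by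
  have ha : a ∈ Substructure.closure L (Set.range g) := hg.closure_eq_top ▸ Substructure.mem_top a
  obtain ⟨t, ht⟩ := Substructure.mem_closure_iff_exists_term.1 ha
  choose i hi using fun x : Set.range g => x.2
  refine ⟨t.relabel i, ?_⟩
  rw [Term.realize_relabel, ← ht]
  congr 1
  exact funext hi

/-- The freeness of `F` with respect to `M` extends to subalgebras of powers of `M`. -/
theorem IsFreeOn.exists_hom_substructure [L.IsAlgebraic] (hg : IsFreeOn L M g) {J : Type w}
    (S : L.Substructure (J → M)) (e : Fin s → S) : ∃ h : F →[L] S, ∀ i, h (g i) = e i := by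
  choose h hh using fun j => hg.exists_hom fun i => (e i).1 j
  have hH : ∀ i, homPi h (g i) = (e i).1 := fun i => funext fun j => hh j i
  have hS : Substructure.closure L (Set.range g) ≤ S.comap (homPi h) := by
    rw [Substructure.closure_le]
    rintro _ ⟨i, rfl⟩
    change homPi h (g i) ∈ S
    rw [hH]
    exact (e i).2
  rw [hg.closure_eq_top] at hS
  exact ⟨(homPi h).codRestrict S fun a => hS (Substructure.mem_top a), fun i => Subtype.ext (hH i)⟩

end Free

/-! ### Morphisms and the algebras `E(X)` -/

section Mor

variable {τ : DualType.{w}}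

/-- The composite of two morphisms. -/
def Mor.comp {X : TopStr.{u, w} τ} {Y : TopStr.{v, w} τ} {Z : TopStr.{v', w} τ} (ψ : Mor Y Z)
    (φ : Mor X Y) : Mor X Z where
  toFun x := ψ.toFun (φ.toFun x)
  continuous_toFun := ψ.continuous_toFun.comp φ.continuous_toFun
  map_gOp g x := by rw [φ.map_gOp, ψ.map_gOp]
  map_hDom h x hx := ψ.map_hDom h _ (φ.map_hDom h x hx)
  map_hOp h x hx := by rw [φ.map_hOp, ψ.map_hOp]
  map_rel r x hx := ψ.map_rel r _ (φ.map_rel r x hx)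

/-- A surjective embedding is an isomorphism, so morphisms extend along it to any target. -/
theorem Mor.IsEmbedding.exists_extension_of_surjective {X : TopStr.{u, w} τ} {Y : TopStr.{v, w} τ}
    {Z : TopStr.{v', w} τ} {φ : Mor X Y} (hφ : φ.IsEmbedding) (hs : Function.Surjective φ.toFun)
    (α : Mor X Z) : ∃ β : Mor Y Z, ∀ x, β.toFun (φ.toFun x) = α.toFun x := by
  obtain ⟨hZ, e, ⟨ψ, hψ, -⟩, he⟩ := hφ
  let ι : Mor Y (Y.sub (Set.range φ.toFun) hZ) :=
    { toFun := fun y => ⟨y, hs y⟩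
      continuous_toFun := continuous_id.subtype_mk _
      map_gOp := fun _ _ => rfl
      map_hDom := fun _ _ hx => hx
      map_hOp := fun _ _ _ => rfl
      map_rel := fun _ _ hx => hx }
  refine ⟨α.comp (ψ.comp ι), fun x => ?_⟩
  have : ι.toFun (φ.toFun x) = e.toFun x := Subtype.ext (he x).symm
  change α.toFun (ψ.toFun (ι.toFun (φ.toFun x))) = _
  rw [this, hψ]

variable {N : TopStr.{u, w} τ}

/-- In a power of a finite discrete structure with finite exponent, every substructure is closed;
`S` may live in a lower universe than the one in which `InIScP` takes its powers. -/
theorem inIScP_sub_pow [Finite N.carrier] [DiscreteTopology N.carrier] {S : Type} [Finite S]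
    [Nonempty S] {Z : Set (N.pow S).carrier} (hZ : IsSubuniverse (N.pow S) Z) :
    InIScP N ((N.pow S).sub Z hZ) := by
  let Z' : Set (N.pow (ULift.{u} S)).carrier := {z | (fun i => z ⟨i⟩) ∈ Z}
  have hZ' : IsSubuniverse (N.pow (ULift.{u} S)) Z' :=
    ⟨fun g x hx => hZ.gOp_mem g (fun k i => x k ⟨i⟩) hx,
      fun h x hd hx => hZ.hOp_mem h (fun k i => x k ⟨i⟩) (fun i => hd ⟨i⟩) hx⟩
  refine Or.inr ⟨ULift.{u} S, inferInstance, Z', hZ', ?_, ?_⟩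
  · have : Finite (N.pow (ULift.{u} S)).carrier :=
      inferInstanceAs (Finite (ULift.{u} S → N.carrier))
    have : T1Space (N.pow (ULift.{u} S)).carrier :=
      inferInstanceAs (T1Space (ULift.{u} S → N.carrier))
    exact (Set.toFinite Z').isClosed
  · refine ⟨⟨fun x => ⟨fun i => x.1 i.down, x.2⟩, ?_, fun _ _ => rfl, fun _ _ hx i => hx i.down,
      fun _ _ _ => rfl, fun _ _ hx i => hx i.down⟩,
      ⟨fun x => ⟨fun i => x.1 ⟨i⟩, x.2⟩, ?_, fun _ _ => rfl, fun _ _ hx i => hx ⟨i⟩,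
      fun _ _ _ => rfl, fun _ _ hx i => hx ⟨i⟩⟩, fun _ => rfl, fun _ => rfl⟩
    · refine Continuous.subtype_mk (continuous_pi fun i => ?_) _
      exact (continuous_apply (A := fun _ : S => N.carrier) i.down).comp continuous_subtype_val
    · refine Continuous.subtype_mk (continuous_pi fun i => ?_) _
      exact (continuous_apply (A := fun _ : ULift.{u} S => N.carrier) ⟨i⟩).comp
        continuous_subtype_val

end Mor

section Dual

variable {L : FirstOrder.Language.{ul, vl}} {M : Type u} [L.Structure M]

instance (N : AlterEgo.{ul, vl, u, w} L M) : DiscreteTopology N.str.carrier := ⟨rfl⟩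

instance [Finite M] (N : AlterEgo.{ul, vl, u, w} L M) : Finite N.str.carrier :=
  inferInstanceAs (Finite M)

variable [L.IsAlgebraic]

theorem AlterEgo.inIScP_D [Finite M] [Nonempty M] (N : AlterEgo.{ul, vl, u, w} L M) :
    InIScP N.str (N.D M) := by
  have : Finite (N.str.pow M).carrier := inferInstanceAs (Finite (M → N.str.carrier))
  have : T1Space (N.str.pow M).carrier := inferInstanceAs (T1Space (M → N.str.carrier))
  exact Or.inr ⟨M, inferInstance, _, N.isSubuniverse_hom M, (Set.toFinite _).isClosed,
    ⟨id, continuous_id, fun _ _ => rfl, fun _ _ hx => hx, fun _ _ _ => rfl, fun _ _ hx => hx⟩,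
    ⟨id, continuous_id, fun _ _ => rfl, fun _ _ hx => hx, fun _ _ _ => rfl, fun _ _ hx => hx⟩,
    fun _ => rfl, fun _ => rfl⟩

/-- The contravariant action of `E` on morphisms: precomposition. -/
def AlterEgo.mapE (N : AlterEgo.{ul, vl, u, w} L M) {X Y : TopStr.{u, w} N.τ} (φ : Mor X Y) :
    N.E Y →[L] N.E X where
  toFun p := ⟨fun x => p.1 (φ.toFun x), by
    obtain ⟨ψ, hψ⟩ := p.2
    exact ⟨ψ.comp φ, fun x => hψ _⟩⟩
  map_fun' _ _ := rfl
  map_rel' r := isEmptyElim r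

theorem AlterEgo.mapE_injective (N : AlterEgo.{ul, vl, u, w} L M) {X Y : TopStr.{u, w} N.τ}
    {φ : Mor X Y} (hφ : Function.Surjective φ.toFun) : Function.Injective (N.mapE φ) := by
  intro p q hpq
  refine Subtype.ext (funext fun y => ?_)
  obtain ⟨x, rfl⟩ := hφ y
  exact congrFun (congrArg Subtype.val hpq) x

/-- The free algebra on `s` generators is isomorphic to the dual of the power `N ^ s`: an element
of it is a term function, and by the duality the morphisms `N ^ s → N` are all of this form. -/
theorem IsFreeOn.exists_equiv_E (N : AlterEgo.{ul, vl, u, w} L M) (hN : N.YieldsDuality)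
    {s : ℕ} {F : Type u} [L.Structure F] (hF : Alg.of F ∈ ISP {Alg.of (L := L) M})
    {g : Fin s → F} (hg : IsFreeOn L M g) : Nonempty (F ≃[L] N.E (N.str.pow (Fin s))) := by
  let pr : Fin s → N.E (N.str.pow (Fin s)) := fun i => ⟨fun x => x i,
    ⟨fun x => x i, continuous_apply (A := fun _ : Fin s => N.str.carrier) i, fun _ _ => rfl,
      fun _ _ hx => hx i, fun _ _ _ => rfl, fun _ _ hx => hx i⟩, fun _ => rfl⟩
  obtain ⟨Φ, hΦ⟩ := hg.exists_hom_substructure (N.E (N.str.pow (Fin s))) pr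
  -- Evaluating `Φ a` at the tuple of values of `h` on the generators gives back `h a`.
  have hev : ∀ (h : F →[L] M) (a : F), (Φ a).1 (fun i => h (g i)) = h a := by
    intro h a
    let k : F →[L] M := (homProj (B := fun _ => M) (fun i => h (g i))).comp
      ((N.E (N.str.pow (Fin s))).subtype.toHom.comp Φ)
    have hk : k = h := hg.hom_ext fun i => by
      change (Φ (g i)).1 _ = _
      rw [hΦ]
    exact congrArg (fun f : F →[L] M => f a) hk
  have hinj : Function.Injective Φ := by
    intro a b hab
    by_contra hne
    obtain ⟨_, rfl, h, hh⟩ := (mem_ISP_iff.1 hF).2 a b hne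
    exact hh (by rw [← hev h a, ← hev h b, hab])
  have hsurj : Function.Surjective Φ := by
    rintro ⟨p, φ, hφ⟩
    -- Restriction to the generators, as a morphism `D(F) → N ^ s`.
    let ρ : Mor (N.D F) (N.str.pow (Fin s)) :=
      { toFun := fun x i => x.1 (g i)
        continuous_toFun := continuous_pi fun i =>
          (continuous_apply (A := fun _ : F => N.str.carrier) (g i)).comp continuous_subtype_val
        map_gOp := fun _ _ => rfl
        map_hDom := fun _ _ hx i => hx (g i)
        map_hOp := fun _ _ _ => rfl
        map_rel := fun _ _ hx i => hx (g i) }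
    obtain ⟨a, ha⟩ := hN (Alg.of F) hF ⟨fun x => φ.toFun (ρ.toFun x), φ.comp ρ, fun _ => rfl⟩
    refine ⟨a, Subtype.ext (funext fun m => ?_)⟩
    obtain ⟨h, hh⟩ := hg.exists_hom m
    obtain rfl : (fun i => h (g i)) = m := funext hh
    have := congrFun (congrArg Subtype.val ha) ⟨fun a => h a, h, fun _ => rfl⟩
    rw [hev]
    exact this.trans (hφ _)
  exact ⟨⟨Equiv.ofBijective Φ ⟨hinj, hsurj⟩, fun f x => Φ.map_fun f x,
    fun r => isEmptyElim r⟩⟩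

/-! ### Test Space configurations -/

variable {N : AlterEgo.{ul, vl, u, w} L M} {s : ℕ}

theorem TSConfig.exists_injective_hom_free (T : TSConfig N s) (hN : N.YieldsDuality)
    {F : Type u} [L.Structure F] (hF : Alg.of F ∈ ISP {Alg.of (L := L) M})
    {g : Fin s → F} (hg : IsFreeOn L M g) :
    ∃ h : N.E T.X →[L] F, Function.Injective h := by
  obtain ⟨e⟩ := hg.exists_equiv_E N hN hF
  exact ⟨e.symm.toHom.comp (N.mapE (Y := T.X) T.γ),
    e.symm.injective.comp (N.mapE_injective T.γ_surjective)⟩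

/-- Evaluation at the image under `η` of the identity map of `M` is onto `M`. -/
theorem TSConfig.exists_surjective_hom [Finite M] [Nonempty M] (T : TSConfig N s)
    (hN : IsInjectiveInIScP N.str) : ∃ h : N.E T.X →[L] M, Function.Surjective h := by
  let idM : (N.D M).carrier := ⟨fun m => m, Hom.id L M, fun _ => rfl⟩
  refine ⟨(homProj (B := fun _ => M) (T.η.toFun idM)).comp (N.E T.X).subtype.toHom, fun m => ?_⟩
  obtain ⟨α, hα⟩ := (N.eval M m).2
  have hext : ∃ β : Mor T.X N.str, ∀ x, β.toFun (T.η.toFun x) = α.toFun x := by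
    rcases Nat.eq_zero_or_pos s with rfl | hs
    · refine T.η_embedding.exists_extension_of_surjective (fun y => ⟨idM, ?_⟩) α
      exact Subtype.ext (funext fun i => i.elim0)
    · have : Nonempty (Fin s) := ⟨⟨0, hs⟩⟩
      exact hN _ _ N.inIScP_D (inIScP_sub_pow T.isSubuniverse) T.η T.η_embedding α
  obtain ⟨β, hβ⟩ := hext
  exact ⟨⟨β.toFun, β, fun _ => rfl⟩, (hβ idM).trans (hα idM)⟩

theorem TSConfig.E_mem_ISP_free (T : TSConfig N s) (hN : N.YieldsDuality)
    {F : Type u} [L.Structure F] (hF : Alg.of F ∈ ISP {Alg.of (L := L) M})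
    {g : Fin s → F} (hg : IsFreeOn L M g) :
    Alg.of (N.E T.X) ∈ ISP {Alg.of (L := L) F} := by
  obtain ⟨e⟩ := hg.exists_equiv_E N hN hF
  obtain ⟨h, hh⟩ := T.exists_injective_hom_free hN hF hg
  obtain ⟨a⟩ := (mem_ISP_iff.1 hF).1
  let ι : Mor T.X (N.str.pow (Fin s)) := ⟨Subtype.val, continuous_subtype_val, fun _ _ => rfl,
    fun _ _ hx => hx, fun _ _ _ => rfl, fun _ _ hx => hx⟩
  exact mem_ISP_iff.2 ⟨⟨N.mapE ι (e a)⟩, fun p q hpq => ⟨_, rfl, h, hh.ne hpq⟩⟩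

theorem TSConfig.free_mem_ISP_E [Finite M] [Nonempty M] (T : TSConfig N s)
    (hN : IsInjectiveInIScP N.str) {F : Type u} [L.Structure F]
    (hF : Alg.of F ∈ ISP {Alg.of (L := L) M}) {g : Fin s → F} (hg : IsFreeOn L M g) :
    Alg.of F ∈ ISP {Alg.of (L := L) (N.E T.X)} := by
  obtain ⟨π, hπ⟩ := T.exists_surjective_hom hN
  refine mem_ISP_iff.2 ⟨(mem_ISP_iff.1 hF).1, fun a b hab => ?_⟩
  obtain ⟨_, rfl, h, hh⟩ := (mem_ISP_iff.1 hF).2 a b hab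
  choose c hc using fun i => hπ (h (g i))
  obtain ⟨k, hk⟩ := hg.exists_hom_substructure (N.E T.X) c
  have hkh : π.comp k = h := hg.hom_ext fun i => by rw [Hom.comp_apply, hk, hc]
  refine ⟨_, rfl, k, fun hkk => hh ?_⟩
  rw [← hkh]
  exact congrArg π hkk

end Dual

/-! ### Admissible quasi-identities -/

section Admissible

variable {L : FirstOrder.Language.{ul, vl}} {q : QuasiIdentity L}

theorem QuasiIdentity.ValidIn.of_injective {A B : Type u} [L.Structure A] [L.Structure B]
    {h : A →[L] B} (hinj : Function.Injective h) (hq : q.ValidIn {Alg.of (L := L) B}) :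
    q.ValidIn {Alg.of (L := L) A} := by
  rintro _ rfl v hv
  exact Identity.SatisfiedBy.of_map hinj (hq _ rfl _ fun e he => (hv e he).map h)

variable [L.IsAlgebraic] {M : Type u} [L.Structure M]

theorem QuasiIdentity.ValidIn.admissible {B : Type u} [L.Structure B]
    (hB : Alg.of B ∈ ISP {Alg.of (L := L) M}) {π : B →[L] M} (hπ : Function.Surjective π)
    (hq : q.ValidIn {Alg.of (L := L) B}) : q.Admissible (ISP {Alg.of (L := L) M}) := by
  intro σ hσ
  refine Identity.validIn_ISP fun v => ?_
  choose w hw using fun n => hπ (v n)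
  obtain rfl : π ∘ w = v := funext hw
  refine Identity.SatisfiedBy.map π (Identity.satisfiedBy_subst.2 ?_)
  exact hq _ rfl _ fun e he => Identity.satisfiedBy_subst.1 (hσ e he _ hB w)

/-- If `q` is admissible, an assignment into the free algebra that satisfies the premises satisfies
the conclusion: its values are terms in the generators, and these terms define a substitution that
makes the premises valid. -/
theorem QuasiIdentity.Admissible.validIn_free (hq : q.Admissible (ISP {Alg.of (L := L) M}))
    {s : ℕ} {F : Type u} [L.Structure F] (hF : Alg.of F ∈ ISP {Alg.of (L := L) M})
    {g : Fin s → F} (hg : IsFreeOn L M g) : q.ValidIn {Alg.of (L := L) F} := by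
  rintro _ rfl v hv
  choose t ht using fun n => hg.exists_term (v n)
  let σ : ℕ → L.Term ℕ := fun n => (t n).relabel Fin.val
  have hval : ∀ e ∈ q.premises, (Identity.subst e σ).ValidIn (ISP {Alg.of (L := L) M}) := by
    intro e he
    refine Identity.validIn_ISP fun w => Identity.satisfiedBy_subst.2 ?_
    obtain ⟨h, hh⟩ := hg.exists_hom fun i => w i
    have hw : (fun n => (σ n).realize w) = h ∘ v := by
      funext n
      rw [Function.comp_apply, ← ht n, ← HomClass.realize_term, Term.realize_relabel]
      congr 1
      exact funext fun i => (hh i).symm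
    rw [hw]
    exact (hv e he).map h
  obtain ⟨a⟩ := (mem_ISP_iff.1 hF).1
  -- The variables from `s` on do not occur in the terms `σ n`, so their value `a` is irrelevant.
  let w : ℕ → F := fun n => if hn : n < s then g ⟨n, hn⟩ else a
  have hw : (fun n => (σ n).realize w) = v := by
    funext n
    rw [← ht n, Term.realize_relabel]
    congr 1
    exact funext fun i => dif_pos i.2
  have hc := Identity.satisfiedBy_subst.1 (hq σ hval _ hF w)
  rw [hw] at hc
  exact hc

end Admissible

end NaturalDuality

theorem proposition6p1 {L : FirstOrder.Language.{ul, vl}} [L.IsAlgebraic]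
    (M : Type u) [L.Structure M] [Finite M] [Nonempty M]
    (N : NaturalDuality.AlterEgo.{ul, vl, u, w} L M) (hN : N.YieldsStrongDuality)
    (s : ℕ)
    (hs : ∃ m : Fin s → M, FirstOrder.Language.Substructure.closure L (Set.range m) = ⊤)
    (T : NaturalDuality.TSConfig N s)
    (F : NaturalDuality.Alg.{ul, vl, u} L)
    (hF : NaturalDuality.IsFreeAlg {NaturalDuality.Alg.of (L := L) M} s F) :
    NaturalDuality.ISP {F} = NaturalDuality.ISP {NaturalDuality.Alg.of (N.E T.X)} ∧
    ∀ q : NaturalDuality.QuasiIdentity L,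
      q.Admissible (NaturalDuality.ISP {NaturalDuality.Alg.of (L := L) M}) ↔
        q.ValidIn {NaturalDuality.Alg.of (N.E T.X)} := by
  obtain ⟨hFM, g, hgen, hext⟩ := hF
  have hg : NaturalDuality.IsFreeOn L M g := ⟨hgen, hext _ rfl⟩
  have hEF := T.E_mem_ISP_free hN.1 hFM hg
  have hFE := T.free_mem_ISP_E hN.2 hFM hg
  refine ⟨Set.Subset.antisymm (NaturalDuality.ISP_subset_of_mem hFE)
    (NaturalDuality.ISP_subset_of_mem hEF), fun q => ⟨fun hq => ?_, fun hq => ?_⟩⟩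
  · obtain ⟨h, hh⟩ := T.exists_injective_hom_free hN.1 hFM hg
    exact NaturalDuality.QuasiIdentity.ValidIn.of_injective hh (hq.validIn_free hFM hg)
  · obtain ⟨π, hπ⟩ := T.exists_surjective_hom hN.2
    exact hq.admissible (NaturalDuality.ISP_subset_of_mem hFM hEF) hπ
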